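/- Let $K$ be a field of characteristic zero. Let $\mathcal F^{(\infty,\infty)}$ be the ring of formal sums $\sum_{i\le r}a_i(t^{-1})\,\eta^i$ ($r\in\mathbb Z$ arbitrary, $a_i(t^{-1})\in K[[t^{-1}]]$) with the product $$P*Q=\sum_{\alpha\ge 0}\frac{1}{\alpha!}\,\partial_\eta^{\alpha}P\cdot\partial_t^{\alpha}Q ,$$ where the products on the right-hand side are the usual commutative ones. Let $K[t^{-1}]\langle\partial_t\rangle\subset K[t,t^{-1}]\langle\partial_t\rangle$ be the rings of differential operators $\sum_v a_v\partial_t^v$ (finite sums) with coefficients in $K[t^{-1}]$, respectively in $K[t,t^{-1}]$, with $\partial_t a=a\,\partial_t+\frac{da}{dt}$. View $\mathcal F^{(\infty,\infty)}$ as a bimodule over $K[t^{-1}]\langle\partial_t\rangle$ through the ring homomorphism $t^{-1}\mapsto t^{-1}$, $\partial_t\mapsto\eta$. Let $Q=\sum_{v=0}^n b_v(t^{-1})\,\partial_t^v\in K[t^{-1}]\langle\partial_t\rangle$ be such that $b_v(0)\neq 0$ for at least one index $v\in\{0,\dots,n\}$. Then there is an isomorphism of left $K[t^{-1}]\langle\partial_t\rangle$-modules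 $$\mathcal F^{(\infty,\infty)}\otimes_{K[t^{-1}]\langle\partial_t\rangle}\frac{K[t^{-1}]\langle\partial_t\rangle}{K[t^{-1}]\langle\partial_t\rangle\cdot Q}\;\cong\;\mathcal F^{(\infty,\infty)}\otimes_{K[t^{-1}]\langle\partial_t\rangle}\frac{K[t,t^{-1}]\langle\partial_t\rangle}{K[t,t^{-1}]\langle\partial_t\rangle\cdot Q}.$$ More precisely, the natural map $f\otimes[P]\mapsto f\otimes[P]$ is such an isomorphism, and it is $\mathcal F^{(\infty,\infty)}$-linear. -/

import Mathlib

noncomputable section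

namespace Microloc

open Finset

/-! ### Formal pseudodifferential operators over a differential ring -/

section PDO

variable {K A : Type*} [CommRing K] [CommRing A] [Algebra K A]

/-- The additive group of families `(a i)` indexed by the integers which vanish for all large `i`. -/
def bddFamilies (A : Type*) [AddCommGroup A] : AddSubgroup (ℤ → A) where
  carrier := {f | ∃ r : ℤ, ∀ i, r < i → f i = 0}
  zero_mem' := ⟨0, fun _ _ => rfl⟩
  add_mem' := by
    rintro f g ⟨r, hr⟩ ⟨s, hs⟩
    refine ⟨max r s, fun i hi => ?_⟩
    simp [hr i (lt_of_le_of_lt (le_max_left _ _) hi), hs i (lt_of_le_of_lt (le_max_right _ _) hi)]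
  neg_mem' := by
    rintro f ⟨r, hr⟩
    exact ⟨r, fun i hi => by simp [hr i hi]⟩

/-- Formal pseudodifferential operators `∑_{i ≤ r} a i η ^ i` (`r` an arbitrary integer) with
coefficients, written on the left, in a commutative ring `A` with a derivation `δ`. -/
def PDO (_δ : Derivation K A A) : Type _ := bddFamilies A

namespace PDO

variable {δ : Derivation K A A}

instance : AddCommGroup (PDO δ) := inferInstanceAs (AddCommGroup (bddFamilies A))

/-- The coefficient of `η ^ i`. -/
def coeff (P : PDO δ) (i : ℤ) : A := P.1 i

@[ext] theorem ext {P Q : PDO δ} (h : ∀ i, P.coeff i = Q.coeff i) : P = Q :=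
  Subtype.ext (funext h)

theorem bdd (P : PDO δ) : ∃ r : ℤ, ∀ i, r < i → P.coeff i = 0 := P.2

@[simp] theorem coeff_zero (i : ℤ) : (0 : PDO δ).coeff i = 0 := rfl
@[simp] theorem coeff_add (P Q : PDO δ) (i : ℤ) :
    (P + Q).coeff i = P.coeff i + Q.coeff i := rfl
@[simp] theorem coeff_neg (P : PDO δ) (i : ℤ) : (-P).coeff i = -P.coeff i := rfl

/-- Constructor from a family of coefficients that vanishes above some degree. -/
def mk (f : ℤ → A) (h : ∃ r : ℤ, ∀ i, r < i → f i = 0) : PDO δ := ⟨f, h⟩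

@[simp] theorem coeff_mk (f : ℤ → A) (h) (i : ℤ) : (mk f h : PDO δ).coeff i = f i := rfl

/-- The contribution of the `η ^ i`-part of `P` to the coefficient of `η ^ k` in
`(1 / α!) (∂_η ^ α P) (δ ^ α Q)`. Since `(1 / α!) ∂_η ^ α (η ^ i) = (i choose α) η ^ (i - α)`, the
partner of `P i η ^ i` is the coefficient of `Q` of index `k + α - i`. -/
def term (P Q : PDO δ) (k i : ℤ) (α : ℕ) : A :=
  Ring.choose i α • (P.coeff i * δ^[α] (Q.coeff (k + α - i)))

theorem iter_zero (α : ℕ) : δ^[α] (0 : A) = 0 := iterate_map_zero δ α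

theorem term_eq_zero {P Q : PDO δ} {p q : ℤ} (hP : ∀ i, p < i → P.coeff i = 0)
    (hQ : ∀ i, q < i → Q.coeff i = 0) {k i : ℤ} {α : ℕ}
    (h : p < i ∨ q < k + α - i) : term P Q k i α = 0 := by
  unfold term
  rcases h with h | h
  · simp [hP i h]
  · rw [hQ _ h, iter_zero]; simp

theorem term_support_finite (P Q : PDO δ) (k : ℤ) :
    (Function.support fun x : ℤ × ℕ => term P Q k x.1 x.2).Finite := by
  obtain ⟨p, hP⟩ := P.bdd
  obtain ⟨q, hQ⟩ := Q.bdd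
  refine Set.Finite.subset (Finset.finite_toSet
    ((Finset.Icc (k - q) p) ×ˢ (Finset.range (p + q - k + 1).toNat))) ?_
  rintro ⟨i, α⟩ h
  have h1 : ¬ (p < i ∨ q < k + α - i) := fun h' => h (term_eq_zero hP hQ h')
  simp only [coe_product, Set.mem_prod, Finset.mem_coe, Finset.mem_Icc, Finset.mem_range]
  omega

/-- The product `∑_{α ≥ 0} (1 / α!) (∂_η ^ α P) (δ ^ α Q)`; each coefficient is a finite sum. -/
instance : Mul (PDO δ) where
  mul P Q := mk (fun k => ∑ᶠ x : ℤ × ℕ, term P Q k x.1 x.2) (by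
    obtain ⟨p, hP⟩ := P.bdd
    obtain ⟨q, hQ⟩ := Q.bdd
    refine ⟨p + q, fun k hk => finsum_eq_zero_of_forall_eq_zero fun x => ?_⟩
    exact term_eq_zero hP hQ (by omega))

theorem coeff_mul (P Q : PDO δ) (k : ℤ) :
    (P * Q).coeff k = ∑ᶠ x : ℤ × ℕ, term P Q k x.1 x.2 := rfl

theorem coeff_mul_of_lt {P Q : PDO δ} {p q : ℤ} (hP : ∀ i, p < i → P.coeff i = 0)
    (hQ : ∀ i, q < i → Q.coeff i = 0) {k : ℤ} (hk : p + q < k) : (P * Q).coeff k = 0 := by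
  rw [coeff_mul]
  exact finsum_eq_zero_of_forall_eq_zero fun x => term_eq_zero hP hQ (by omega)

theorem coeff_mul_eq_sum {P Q : PDO δ} {p q : ℤ} (hP : ∀ i, p < i → P.coeff i = 0)
    (hQ : ∀ i, q < i → Q.coeff i = 0) {k a : ℤ} {N : ℕ} (ha : a ≤ k - q)
    (hN : p + q - k < N) :
    (P * Q).coeff k = ∑ i ∈ Finset.Icc a p, ∑ α ∈ Finset.range N, term P Q k i α := by
  rw [coeff_mul, ← Finset.sum_product']
  refine finsum_eq_sum_of_support_subset _ ?_
  rintro ⟨i, α⟩ h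
  have h1 : ¬ (p < i ∨ q < k + α - i) := fun h' => h (term_eq_zero hP hQ h')
  simp only [coe_product, Set.mem_prod, Finset.mem_coe, Finset.mem_Icc, Finset.mem_range]
  omega

theorem add_mul' (P Q R : PDO δ) : (P + Q) * R = P * R + Q * R := by
  ext k
  rw [coeff_add, coeff_mul, coeff_mul, coeff_mul,
    ← finsum_add_distrib (term_support_finite P R k) (term_support_finite Q R k)]
  refine finsum_congr fun x => ?_
  simp [term, add_mul]

theorem mul_add' (P Q R : PDO δ) : P * (Q + R) = P * Q + P * R := by
  ext k
  rw [coeff_add, coeff_mul, coeff_mul, coeff_mul,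
    ← finsum_add_distrib (term_support_finite P Q k) (term_support_finite P R k)]
  refine finsum_congr fun x => ?_
  simp [term, mul_add, iterate_map_add]

/-- The monomial `a η ^ n`. -/
def monomial (n : ℤ) (a : A) : PDO δ :=
  mk (fun i => if i = n then a else 0) ⟨n, fun _ hi => if_neg hi.ne'⟩

@[simp] theorem coeff_monomial (n : ℤ) (a : A) (i : ℤ) :
    (monomial n a : PDO δ).coeff i = if i = n then a else 0 := rfl

instance : One (PDO δ) := ⟨monomial 0 1⟩

theorem coeff_one (i : ℤ) : (1 : PDO δ).coeff i = if i = 0 then 1 else 0 := rfl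

theorem monomial_zero_mul_coeff (a : A) (P : PDO δ) (k : ℤ) :
    (monomial 0 a * P).coeff k = a * P.coeff k := by
  rw [coeff_mul, finsum_eq_single _ ((0 : ℤ), (0 : ℕ))]
  · simp [term]
  · rintro ⟨i, α⟩ h
    by_cases hi : i = 0
    · subst hi
      have hα : 0 < α := Nat.pos_of_ne_zero fun h0 => h (by rw [h0])
      simp [term, Ring.choose_zero_pos ℤ hα]
    · simp [term, hi]

theorem one_mul' (P : PDO δ) : 1 * P = P := by
  ext k
  exact (monomial_zero_mul_coeff 1 P k).trans (one_mul _)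

theorem iter_one {α : ℕ} (h : 0 < α) : δ^[α] (1 : A) = 0 := by
  obtain ⟨n, rfl⟩ := Nat.exists_eq_succ_of_ne_zero h.ne'
  rw [Function.iterate_succ_apply, Derivation.map_one_eq_zero, iter_zero]

theorem mul_one' (P : PDO δ) : P * 1 = P := by
  ext k
  rw [coeff_mul, finsum_eq_single _ (k, (0 : ℕ))]
  · simp [term, coeff_one]
  · rintro ⟨i, α⟩ h
    rcases Nat.eq_zero_or_pos α with rfl | hα
    · have : ¬ (k - i = 0) := fun h0 => h (by rw [show i = k by omega])
      simp [term, coeff_one, this]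
    · rw [term, coeff_one]
      split_ifs
      · simp [iter_one hα]
      · simp

theorem iter_sum {ι : Type*} (n : ℕ) (s : Finset ι) (f : ι → A) :
    δ^[n] (∑ j ∈ s, f j) = ∑ j ∈ s, δ^[n] (f j) := by
  induction n with
  | zero => rfl
  | succ n ih => simp only [Function.iterate_succ_apply', ih, map_sum]

theorem iter_zsmul (n : ℕ) (c : ℤ) (a : A) : δ^[n] (c • a) = c • δ^[n] a := by
  induction n with
  | zero => rfl
  | succ n ih => simp only [Function.iterate_succ_apply', ih, map_zsmul]

/-- Iterated Leibniz rule. -/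
theorem iter_mul (n : ℕ) (a b : A) :
    δ^[n] (a * b) = ∑ x ∈ antidiagonal n, n.choose x.1 • (δ^[x.1] a * δ^[x.2] b) := by
  induction n with
  | zero => simp
  | succ n ih =>
    rw [Function.iterate_succ_apply', ih, map_sum,
      Finset.sum_antidiagonal_choose_succ_nsmul (fun i j => δ^[i] a * δ^[j] b) n,
      ← Finset.sum_add_distrib]
    refine Finset.sum_congr rfl fun x hx => ?_
    have : x.2 ≤ n := by have := HasAntidiagonal.mem_antidiagonal.1 hx; omega
    rw [Nat.choose_symm_of_eq_add (HasAntidiagonal.mem_antidiagonal.1 hx).symm]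
    simp only [map_nsmul, Derivation.leibniz, smul_eq_mul, Function.iterate_succ_apply']
    rw [← nsmul_add]
    congr 1
    ring

/-- The combinatorial identity behind associativity. -/
theorem assoc_aux (i j : ℤ) (N : ℕ) (g : ℕ → ℕ → A) (hg : ∀ α β, N ≤ α + β → g α β = 0) :
    ∑ ε ∈ range N, ∑ γ ∈ range N, ∑ x ∈ antidiagonal ε,
      (Ring.choose i ε * Ring.choose j γ * (ε.choose x.1 : ℤ)) • g x.1 (x.2 + γ) =
    ∑ α ∈ range N, ∑ β ∈ range N,
      (Ring.choose i α * Ring.choose (i + j - α) β) • g α β := by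
  have hR : ∀ α ∈ range N, ∀ β ∈ range N,
      (Ring.choose i α * Ring.choose (i + j - α) β) • g α β =
      ∑ y ∈ antidiagonal β,
        (Ring.choose i α * (Ring.choose (i - α) y.1 * Ring.choose j y.2)) •
          g α (y.1 + y.2) := by
    intro α _ β _
    rw [show i + j - (α : ℤ) = (i - α) + j by ring, Ring.add_choose_eq β (Commute.all _ _),
      Finset.mul_sum, Finset.sum_smul]
    refine Finset.sum_congr rfl fun y hy => ?_
    rw [HasAntidiagonal.mem_antidiagonal.1 hy]
  rw [Finset.sum_congr rfl fun α hα => Finset.sum_congr rfl (hR α hα)]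
  have hL : ∀ ε ∈ range N, ∀ γ ∈ range N, ∀ x ∈ antidiagonal ε,
      (Ring.choose i ε * Ring.choose j γ * (ε.choose x.1 : ℤ)) • g x.1 (x.2 + γ) =
      (Ring.choose i x.1 * (Ring.choose (i - x.1) x.2 * Ring.choose j γ)) •
        g x.1 (x.2 + γ) := by
    intro ε _ γ _ x hx
    have hx' := HasAntidiagonal.mem_antidiagonal.1 hx
    have h := Ring.choose_smul_choose i (n := ε) (k := x.1) (by omega)
    rw [show ε - x.1 = x.2 by omega, nsmul_eq_mul] at h
    congr 1
    linear_combination Ring.choose j γ * h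
  rw [Finset.sum_congr rfl fun ε hε => Finset.sum_congr rfl fun γ hγ =>
    Finset.sum_congr rfl (hL ε hε γ hγ)]
  set F : ℕ → ℕ → ℕ → A := fun α α' γ =>
    (Ring.choose i α * (Ring.choose (i - α) α' * Ring.choose j γ)) • g α (α' + γ) with hF
  have hF0 : ∀ α α' γ, N ≤ α + (α' + γ) → F α α' γ = 0 := by
    intro α α' γ h
    simp [hF, hg _ _ h]
  change ∑ ε ∈ range N, ∑ γ ∈ range N, ∑ x ∈ antidiagonal ε, F x.1 x.2 γ =
    ∑ α ∈ range N, ∑ β ∈ range N, ∑ y ∈ antidiagonal β, F α y.1 y.2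
  have key : ∀ f : ℕ → ℕ → A, (∀ a b, N ≤ a + b → f a b = 0) →
      ∑ ε ∈ range N, ∑ x ∈ antidiagonal ε, f x.1 x.2 =
        ∑ a ∈ range N, ∑ b ∈ range N, f a b := by
    intro f hf
    rw [← Finset.sum_product', Finset.sum_sigma']
    refine Finset.sum_bij_ne_zero (fun z _ _ => z.2) ?_ ?_ ?_ ?_
    · rintro ⟨ε, a, b⟩ h _
      simp only [mem_sigma, mem_range, HasAntidiagonal.mem_antidiagonal, mem_product] at h ⊢
      omega
    · rintro ⟨ε, x⟩ h _ ⟨ε', x'⟩ h' _ e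
      simp only [mem_sigma, mem_range, HasAntidiagonal.mem_antidiagonal] at h h' e
      subst e
      obtain rfl : ε = ε' := by omega
      rfl
    · rintro ⟨a, b⟩ h hne
      have : a + b < N := by
        by_contra hc
        exact hne (hf a b (not_lt.1 hc))
      exact ⟨⟨a + b, a, b⟩, by simp [this], hne, rfl⟩
    · intros; rfl
  have e1 : ∑ ε ∈ range N, ∑ γ ∈ range N, ∑ x ∈ antidiagonal ε, F x.1 x.2 γ =
      ∑ α ∈ range N, ∑ α' ∈ range N, ∑ γ ∈ range N, F α α' γ := by
    rw [Finset.sum_comm, Finset.sum_congr rfl fun γ _ => key (fun a b => F a b γ)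
      (fun a b h => hF0 a b γ (by omega)), Finset.sum_comm]
    exact Finset.sum_congr rfl fun α _ => Finset.sum_comm
  have e2 : ∑ α ∈ range N, ∑ β ∈ range N, ∑ y ∈ antidiagonal β, F α y.1 y.2 =
      ∑ α ∈ range N, ∑ α' ∈ range N, ∑ γ ∈ range N, F α α' γ :=
    Finset.sum_congr rfl fun α _ => key (fun a b => F α a b)
      (fun a b h => hF0 α a b (by omega))
  rw [e1, e2]

theorem mul_assoc' (P Q R : PDO δ) : P * Q * R = P * (Q * R) := by
  obtain ⟨p, hP⟩ := P.bdd
  obtain ⟨q, hQ⟩ := Q.bdd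
  obtain ⟨r, hR⟩ := R.bdd
  ext k
  set N : ℕ := (p + q + r - k + 1).toNat with hN
  set I := Finset.Icc (k - r - q) p with hI
  set J := Finset.Icc (k - r - p) q with hJ
  set G : ℤ → ℤ → ℕ → ℕ → A := fun i j α β =>
    P.coeff i * (δ^[α] (Q.coeff j) * δ^[β] (R.coeff (k + α + β - i - j))) with hG
  trans ∑ i ∈ I, ∑ j ∈ J, ∑ α ∈ range N, ∑ β ∈ range N,
      (Ring.choose i α * Ring.choose (i + j - α) β) • G i j α β
  · rw [coeff_mul_eq_sum (fun _ h => coeff_mul_of_lt hP hQ h) hR (le_refl (k - r))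
      (show p + q + r - k < (N : ℤ) by omega)]
    have h1 : ∀ m ∈ Finset.Icc (k - r) (p + q), ∀ β ∈ range N, term (P * Q) R k m β =
        ∑ i ∈ I, ∑ α ∈ range N, (Ring.choose i α * Ring.choose m β) •
          (P.coeff i * (δ^[α] (Q.coeff (m + α - i)) * δ^[β] (R.coeff (k + β - m)))) := by
      intro m hm β _
      rw [Finset.mem_Icc] at hm
      rw [term, coeff_mul_eq_sum hP hQ (show k - r - q ≤ m - q by omega)
        (show p + q - m < (N : ℤ) by omega), Finset.sum_mul, Finset.smul_sum]
      refine Finset.sum_congr rfl fun i _ => ?_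
      rw [Finset.sum_mul, Finset.smul_sum]
      refine Finset.sum_congr rfl fun α _ => ?_
      simp only [term, zsmul_eq_mul]
      push_cast
      ring
    rw [Finset.sum_congr rfl fun m hm => Finset.sum_congr rfl (h1 m hm)]
    rw [Finset.sum_congr rfl fun m _ => Finset.sum_comm, Finset.sum_comm]
    refine Finset.sum_congr rfl fun i hi => ?_
    rw [Finset.sum_congr rfl fun m _ => Finset.sum_comm, Finset.sum_comm,
      Finset.sum_comm (s := J)]
    refine Finset.sum_congr rfl fun α _ => ?_
    rw [Finset.sum_comm, Finset.sum_comm (s := J)]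
    refine Finset.sum_congr rfl fun β _ => ?_
    rw [Finset.mem_Icc] at hi
    refine Finset.sum_bij_ne_zero (fun m _ _ => m + α - i) ?_ ?_ ?_ ?_
    · intro m hm hne
      rw [Finset.mem_Icc] at hm ⊢
      refine ⟨by omega, ?_⟩
      by_contra hc
      exact hne (by rw [hQ _ (not_le.1 hc), iter_zero]; simp)
    · intro m _ _ m' _ _ e
      omega
    · intro j hj hne
      rw [Finset.mem_Icc] at hj
      have hle : k + α + β - i - j ≤ r := by
        by_contra hc
        exact hne (by simp only [hG]; rw [hR _ (not_le.1 hc), iter_zero]; simp)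
      refine ⟨i + j - α, ?_, ?_, by omega⟩
      · rw [Finset.mem_Icc]; omega
      · rw [show i + j - (α : ℤ) + α - i = j by ring,
          show k + (β : ℤ) - (i + j - α) = k + α + β - i - j by ring]
        exact hne
    · intro m _ _
      simp only [hG]
      rw [show i + (m + α - i) - (α : ℤ) = m by ring,
        show k + (α : ℤ) + β - i - (m + α - i) = k + β - m by ring]
  · rw [coeff_mul_eq_sum hP (fun _ h => coeff_mul_of_lt hQ hR h)
      (show k - r - q ≤ k - (q + r) by omega) (show p + (q + r) - k < (N : ℤ) by omega)]
    refine Finset.sum_congr rfl fun i hi => ?_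
    rw [Finset.mem_Icc] at hi
    have h2 : ∀ ε ∈ range N, term P (Q * R) k i ε = ∑ j ∈ J, ∑ γ ∈ range N,
        ∑ x ∈ antidiagonal ε, (Ring.choose i ε * Ring.choose j γ * (ε.choose x.1 : ℤ)) •
          G i j x.1 (x.2 + γ) := by
      intro ε _
      rw [term, coeff_mul_eq_sum hQ hR (show k - r - p ≤ k + ε - i - r by omega)
        (show q + r - (k + ε - i) < (N : ℤ) by omega)]
      rw [iter_sum, Finset.mul_sum, Finset.smul_sum]
      refine Finset.sum_congr rfl fun j _ => ?_
      rw [iter_sum, Finset.mul_sum, Finset.smul_sum]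
      refine Finset.sum_congr rfl fun γ _ => ?_
      rw [term, iter_zsmul, iter_mul, Finset.smul_sum, Finset.mul_sum, Finset.smul_sum]
      refine Finset.sum_congr rfl fun x hx => ?_
      have hx' := HasAntidiagonal.mem_antidiagonal.1 hx
      simp only [hG]
      rw [← Function.iterate_add_apply,
        show k + (ε : ℤ) - i + γ - j = k + x.1 + ((x.2 + γ : ℕ) : ℤ) - i - j by
          push_cast; omega]
      simp only [zsmul_eq_mul, nsmul_eq_mul]
      push_cast
      ring
    rw [Finset.sum_congr rfl h2]
    trans ∑ j ∈ J, ∑ α ∈ range N, ∑ β ∈ range N,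
      (Ring.choose i α * Ring.choose (i + j - α) β) • G i j α β
    · rfl
    rw [Finset.sum_comm (s := range N)]
    refine Finset.sum_congr rfl fun j hj => ?_
    rw [Finset.mem_Icc] at hj
    refine (assoc_aux i j N (G i j) fun α β h => ?_).symm
    simp only [hG]
    rw [hR _ (by omega), iter_zero]
    simp

instance : Ring (PDO δ) where
  __ := (inferInstance : AddCommGroup (PDO δ))
  __ := (inferInstance : Mul (PDO δ))
  __ := (inferInstance : One (PDO δ))
  left_distrib := mul_add'
  right_distrib := add_mul'
  zero_mul P := by
    have h := add_mul' 0 0 P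
    rwa [add_zero, left_eq_add] at h
  mul_zero P := by
    have h := mul_add' P 0 0
    rwa [add_zero, left_eq_add] at h
  mul_assoc := mul_assoc'
  one_mul := one_mul'
  mul_one := mul_one'


/-- The ring homomorphism induced by a homomorphism of differential rings, applied to each
coefficient. -/
def map {B : Type*} [CommRing B] [Algebra K B] {δ' : Derivation K B B} (f : A →+* B)
    (hf : ∀ a, f (δ a) = δ' (f a)) : PDO δ →+* PDO δ' where
  toFun P := mk (fun i => f (P.coeff i)) (by
    obtain ⟨p, hP⟩ := P.bdd
    exact ⟨p, fun i hi => by rw [hP i hi, map_zero]⟩)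
  map_zero' := by ext i; simp
  map_add' P Q := by ext i; simp
  map_one' := by
    ext i
    simp only [coeff_mk, coeff_one]
    split_ifs <;> simp
  map_mul' P Q := by
    ext k
    have hit : ∀ (n : ℕ) (a : A), f (δ^[n] a) = δ'^[n] (f a) := fun n a => by
      induction n with
      | zero => rfl
      | succ n ih => simp only [Function.iterate_succ_apply', hf, ih]
    rw [coeff_mk, coeff_mul, coeff_mul,
      show f (∑ᶠ x : ℤ × ℕ, term P Q k x.1 x.2) = (f : A →+ B) (∑ᶠ x : ℤ × ℕ, term P Q k x.1 x.2)
        from rfl,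
      AddMonoidHom.map_finsum _ (term_support_finite P Q k)]
    refine finsum_congr fun x => ?_
    simp [term, hit]

@[simp] theorem coeff_map {B : Type*} [CommRing B] [Algebra K B] {δ' : Derivation K B B}
    (f : A →+* B) (hf : ∀ a, f (δ a) = δ' (f a)) (P : PDO δ) (i : ℤ) :
    (map f hf P : PDO δ').coeff i = f (P.coeff i) := rfl

end PDO

/-- The ring `A⟨∂⟩` of differential operators `∑_{0 ≤ v ≤ n} a v ∂ ^ v` over the differential ring
`(A, δ)`: the free left `A`-module on the powers of `∂`, with the product determined by
`∂ * a = a * ∂ + δ a`. It is the subring of the formal pseudodifferential operators in which only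
nonnegative powers of `η = ∂` occur. -/
def DiffOp (δ : Derivation K A A) : Subring (PDO δ) where
  carrier := {P | ∀ i : ℤ, i < 0 → P.coeff i = 0}
  zero_mem' := fun _ _ => rfl
  one_mem' := fun i hi => by rw [PDO.coeff_one, if_neg hi.ne]
  add_mem' := by
    intro P Q hP hQ i hi
    rw [PDO.coeff_add, hP i hi, hQ i hi, add_zero]
  neg_mem' := by
    intro P hP i hi
    rw [PDO.coeff_neg, hP i hi, neg_zero]
  mul_mem' := by
    intro P Q hP hQ k hk
    rw [PDO.coeff_mul]
    refine finsum_eq_zero_of_forall_eq_zero ?_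
    rintro ⟨i, α⟩
    dsimp only
    rcases lt_or_ge i 0 with hi | hi
    · simp [PDO.term, hP i hi]
    · rcases lt_or_ge (k + α - i) 0 with hj | hj
      · rw [PDO.term, hQ _ hj, PDO.iter_zero]; simp
      · obtain ⟨m, rfl⟩ := Int.eq_ofNat_of_zero_le hi
        have : m < α := by omega
        simp [PDO.term, Ring.choose_natCast, Nat.choose_eq_zero_of_lt this]

namespace DiffOp

variable {δ : Derivation K A A}

/-- An element of `A`, as a differential operator of order zero. -/
def coef (δ : Derivation K A A) (a : A) : DiffOp δ :=
  ⟨PDO.monomial 0 a, fun i hi => by rw [PDO.coeff_monomial, if_neg hi.ne]⟩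

/-- The operator `∂`. -/
def del (δ : Derivation K A A) : DiffOp δ :=
  ⟨PDO.monomial 1 1, fun i hi => by rw [PDO.coeff_monomial, if_neg (by omega)]⟩

/-- Coefficientwise map of rings of differential operators. -/
def map {B : Type*} [CommRing B] [Algebra K B] {δ' : Derivation K B B} (f : A →+* B)
    (hf : ∀ a, f (δ a) = δ' (f a)) : DiffOp δ →+* DiffOp δ' :=
  (PDO.map f hf).restrict (DiffOp δ) (DiffOp δ') fun P hP i hi => by
    rw [PDO.coeff_map, hP i hi, map_zero]

/-- The defining relation `∂ * a = a * ∂ + δ a`. -/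
theorem del_mul_coef (a : A) :
    del δ * coef δ a = coef δ a * del δ + coef δ (δ a) := by
  refine Subtype.ext (PDO.ext fun k => ?_)
  have h1 : ((coef δ a * del δ + coef δ (δ a) : DiffOp δ) : PDO δ).coeff k =
      a * (if k = 1 then 1 else 0) + if k = 0 then δ a else 0 := by
    change (PDO.monomial 0 a * PDO.monomial 1 1 : PDO δ).coeff k + _ = _
    rw [PDO.monomial_zero_mul_coeff]
    rfl
  rw [h1]
  change (PDO.monomial 1 1 * PDO.monomial 0 a : PDO δ).coeff k = _
  rw [PDO.coeff_mul_eq_sum (p := 1) (q := 0) (a := min k 1) (N := (2 - k).toNat + 2)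
    (fun i hi => by rw [PDO.coeff_monomial, if_neg (by omega)])
    (fun i hi => by rw [PDO.coeff_monomial, if_neg (by omega)]) (by omega) (by omega),
    Finset.sum_eq_single 1]
  · rw [Finset.sum_range_succ', Finset.sum_range_succ', Finset.sum_eq_zero]
    · have h2 : k + 1 - 1 = 0 ↔ k = 0 := by omega
      have h3 : k - 1 = 0 ↔ k = 1 := by omega
      simp only [PDO.term, PDO.coeff_monomial]
      norm_num [h2, h3]
      split_ifs <;> simp_all
    · intro α _
      have : Ring.choose (1 : ℤ) (α + 1 + 1) = 0 := by
        have := Ring.choose_natCast (R := ℤ) 1 (α + 1 + 1)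
        rw [Nat.choose_eq_zero_of_lt (by omega)] at this
        exact_mod_cast this
      simp [PDO.term, this]
  · intro i _ hi
    exact Finset.sum_eq_zero fun α _ => by simp [PDO.term, hi]
  · intro h
    simp at h

end DiffOp

end PDO

/-! ### Extension of scalars along a homomorphism of noncommutative rings -/

section Tensor

open TensorProduct

variable {R S : Type*} [Ring R] [Ring S]

/-- The relations `(s * φ r) ⊗ m = s ⊗ (r • m)`. -/
def balancing (φ : R →+* S) (M : Type*) [AddCommGroup M] [Module R M] :
    Submodule S (S ⊗[ℤ] M) :=
  Submodule.span S {x | ∃ (s : S) (r : R) (m : M), x = (s * φ r) ⊗ₜ[ℤ] m - s ⊗ₜ[ℤ] (r • m)}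

/-- The left `S`-module `S ⊗_R M`, where `S` is a right `R`-module through `φ` and `M` is a left
`R`-module. -/
def ExtendScalars (φ : R →+* S) (M : Type*) [AddCommGroup M] [Module R M] : Type _ :=
  (S ⊗[ℤ] M) ⧸ balancing φ M

variable (φ : R →+* S) (M : Type*) [AddCommGroup M] [Module R M]

instance : AddCommGroup (ExtendScalars φ M) :=
  inferInstanceAs (AddCommGroup ((S ⊗[ℤ] M) ⧸ balancing φ M))

instance : Module S (ExtendScalars φ M) :=
  inferInstanceAs (Module S ((S ⊗[ℤ] M) ⧸ balancing φ M))

variable {M}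

/-- The pure tensor `s ⊗ m`. -/
def ExtendScalars.tmul (s : S) (m : M) : ExtendScalars φ M :=
  (balancing φ M).mkQ (s ⊗ₜ[ℤ] m)

end Tensor

/-! ### The rings of the `(∞, ∞)`-microlocalization -/

section Rings

open Polynomial LaurentPolynomial

variable (K : Type*) [Field K]

/-- The derivation `d/dt` of `K[t⁻¹]`; the variable `X` of the polynomial ring stands for `t⁻¹`,
so that `d/dt = -X² d/dX`. -/
def polyD : Derivation K K[X] K[X] := (-(X ^ 2) : K[X]) • Polynomial.derivative'

/-- The derivation `d/dt` of `K[[t⁻¹]]`; the variable `X` stands for `t⁻¹`. -/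
def seriesD : Derivation K (PowerSeries K) (PowerSeries K) :=
  (-(PowerSeries.X ^ 2) : PowerSeries K) • PowerSeries.derivative K

/-- The linear map `d/dt` of `K[t, t⁻¹]`, that is `t ^ n ↦ n t ^ (n - 1)`; here `T n` is `t ^ n`. -/
def laurentDLin : K[T;T⁻¹] →ₗ[K] K[T;T⁻¹] :=
  (Finsupp.lsum K fun n : ℤ =>
    LinearMap.toSpanSingleton K K[T;T⁻¹] ((n : K) • T (n - 1))) ∘ₗ
    (AddMonoidAlgebra.coeffLinearEquiv K).toLinearMap

theorem laurentDLin_C_mul_T (a : K) (n : ℤ) :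
    laurentDLin K (LaurentPolynomial.C a * T n) =
      LaurentPolynomial.C (a * n) * T (n - 1) := by
  rw [← LaurentPolynomial.single_eq_C_mul_T]
  rw [laurentDLin, LinearMap.comp_apply]
  change Finsupp.lsum K _ (Finsupp.single n a) = _
  simp only [Finsupp.lsum_single, LinearMap.toSpanSingleton_apply,
    LaurentPolynomial.smul_eq_C_mul, map_mul, mul_assoc]

/-- The derivation `d/dt` of `K[t, t⁻¹]`. -/
def laurentD : Derivation K K[T;T⁻¹] K[T;T⁻¹] :=
  Derivation.mk' (laurentDLin K) (by
    intro p q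
    induction p using LaurentPolynomial.induction_on' with
    | add p p' hp hp' =>
      simp only [add_mul, map_add, hp, hp', add_smul, smul_add]; abel
    | C_mul_T m a =>
      induction q using LaurentPolynomial.induction_on' with
      | add q q' hq hq' =>
        simp only [mul_add, map_add, hq, hq', add_smul, smul_add]; abel
      | C_mul_T n b =>
        have h1 : LaurentPolynomial.C a * T m * (LaurentPolynomial.C b * T n) =
            LaurentPolynomial.C (a * b) * T (m + n) := by
          rw [map_mul, T_add]; ring
        have h2 : ∀ i j : ℤ, T (i + j - 1) = (T i * T (j - 1) : K[T;T⁻¹]) := fun i j => by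
          rw [← T_add, add_sub_assoc]
        rw [h1, laurentDLin_C_mul_T, laurentDLin_C_mul_T, laurentDLin_C_mul_T, smul_eq_mul,
          smul_eq_mul]
        have e1 : T (m + n - 1) = (T m * T (n - 1) : K[T;T⁻¹]) := h2 m n
        have e2 : T n * T (m - 1) = (T m * T (n - 1) : K[T;T⁻¹]) := by
          rw [← h2, ← h2, add_comm]
        simp only [map_mul, Int.cast_add, map_add]
        linear_combination (LaurentPolynomial.C a * LaurentPolynomial.C b *
          (LaurentPolynomial.C (m : K) + LaurentPolynomial.C (n : K))) * e1 -
          (LaurentPolynomial.C a * LaurentPolynomial.C b * LaurentPolynomial.C (m : K)) * e2)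

/-- The ring `K[t⁻¹]⟨∂_t⟩`. -/
abbrev W : Type _ := DiffOp (polyD K)

/-- The ring `K[t, t⁻¹]⟨∂_t⟩`. -/
abbrev D : Type _ := DiffOp (laurentD K)

/-- The ring `F^{(∞, ∞)}` of formal sums `∑_{i ≤ r} a_i(t⁻¹) η ^ i` with `a_i(t⁻¹) ∈ K[[t⁻¹]]`. -/
abbrev F : Type _ := PDO (seriesD K)

theorem series_comm (a : K[X]) :
    Polynomial.coeToPowerSeries.ringHom (polyD K a) =
      seriesD K (Polynomial.coeToPowerSeries.ringHom a) := by
  simp [polyD, seriesD, PowerSeries.derivative_coe]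

theorem laurent_comm (a : K[X]) :
    (Polynomial.aeval (T (-1) : K[T;T⁻¹])).toRingHom (polyD K a) =
      laurentD K ((Polynomial.aeval (T (-1) : K[T;T⁻¹])).toRingHom a) := by
  have hT : laurentD K (T (-1)) = -T (-2) := by
    have := laurentDLin_C_mul_T K 1 (-1)
    simpa [laurentD] using this
  induction a using Polynomial.induction_on' with
  | add p q hp hq => simp only [map_add, hp, hq]
  | monomial n a =>
    rw [← Polynomial.C_mul_X_pow_eq_monomial]
    have hd : polyD K (Polynomial.C a * X ^ n) = Polynomial.C a * ((n : K[X]) * X ^ (n - 1) * (-(X ^ 2))) := by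
      simp only [polyD, Derivation.smul_apply, Polynomial.derivative'_apply,
        Polynomial.derivative_C_mul_X_pow, smul_eq_mul, map_mul, map_natCast]
      ring
    have hs : (T (-2) : K[T;T⁻¹]) = T (-1) ^ 2 := by rw [T_pow]; norm_num
    rw [hd]
    simp only [AlgHom.toRingHom_eq_coe, RingHom.coe_coe, map_mul, map_pow, aeval_X, aeval_C,
      map_neg, map_natCast, Derivation.leibniz, Derivation.leibniz_pow, hT, hs,
      Derivation.map_algebraMap, smul_eq_mul, nsmul_eq_mul]
    ring

/-- The homomorphism `K[t⁻¹]⟨∂_t⟩ → F^{(∞, ∞)}` with `t⁻¹ ↦ t⁻¹` and `∂_t ↦ η`. -/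
def phi : W K →+* F K :=
  (PDO.map Polynomial.coeToPowerSeries.ringHom (series_comm K)).comp (DiffOp (polyD K)).subtype

/-- The inclusion `K[t⁻¹]⟨∂_t⟩ → K[t, t⁻¹]⟨∂_t⟩`. -/
def incl : W K →+* D K :=
  DiffOp.map (Polynomial.aeval (T (-1) : K[T;T⁻¹])).toRingHom (laurent_comm K)

variable {K}

/-- The left `K[t⁻¹]⟨∂_t⟩`-module `K[t⁻¹]⟨∂_t⟩ / K[t⁻¹]⟨∂_t⟩ Q`. -/
abbrev QuotW (Q : W K) : Type _ := W K ⧸ Submodule.span (W K) {Q}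

/-- The left `K[t, t⁻¹]⟨∂_t⟩`-module `K[t, t⁻¹]⟨∂_t⟩ / K[t, t⁻¹]⟨∂_t⟩ Q`. -/
def QuotD (Q : W K) : Type _ := D K ⧸ Submodule.span (D K) {incl K Q}

instance (Q : W K) : AddCommGroup (QuotD Q) :=
  inferInstanceAs (AddCommGroup (D K ⧸ Submodule.span (D K) {incl K Q}))

instance (Q : W K) : Module (D K) (QuotD Q) :=
  inferInstanceAs (Module (D K) (D K ⧸ Submodule.span (D K) {incl K Q}))

/-- `K[t, t⁻¹]⟨∂_t⟩ / K[t, t⁻¹]⟨∂_t⟩ Q` as a left module over `K[t⁻¹]⟨∂_t⟩`. -/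
instance (Q : W K) : Module (W K) (QuotD Q) := Module.compHom _ (incl K)

/-- The class of `P` modulo `K[t⁻¹]⟨∂_t⟩ Q`. -/
def QuotW.mk (Q P : W K) : QuotW Q := Submodule.Quotient.mk P

/-- The class of `P` modulo `K[t, t⁻¹]⟨∂_t⟩ Q`. -/
def QuotD.mk (Q : W K) (P : D K) : QuotD Q :=
  (Submodule.Quotient.mk P : D K ⧸ Submodule.span (D K) {incl K Q})

/-- `F^{(∞, ∞)} ⊗ M` over `K[t⁻¹]⟨∂_t⟩`, for a left `K[t⁻¹]⟨∂_t⟩`-module `M`. -/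
abbrev Microlocalization (M : Type*) [AddCommGroup M] [Module (W K) M] : Type _ :=
  ExtendScalars (phi K) M

/-- `K[t⁻¹]⟨∂_t⟩` acts on `F^{(∞, ∞)} ⊗ M` through the left factor. -/
instance (M : Type*) [AddCommGroup M] [Module (W K) M] :
    Module (W K) (ExtendScalars (phi K) M) := Module.compHom _ (phi K)

/-- The operator `∑_{v = 0}^n b_v(t⁻¹) ∂_t ^ v`. -/
def operator (n : ℕ) (b : ℕ → K[X]) : W K :=
  ∑ v ∈ Finset.range (n + 1), DiffOp.coef (polyD K) (b v) * DiffOp.del (polyD K) ^ v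

end Rings

end Microloc

end

noncomputable section

namespace Microloc

open Finset

/-! ### Commutation with a coefficient in formal pseudodifferential operators -/

namespace PDO

variable {K A : Type*} [CommRing K] [CommRing A] [Algebra K A] {δ : Derivation K A A}

/-! Write `x = t⁻¹`, `W`, `D`, `F` for the three rings, and split off the constant terms of the
coefficients: `Q = Q₀ + x R` (`operator_eq`). The image of `Q₀` in `F` is a nonzero Laurent series
in `η⁻¹` over `K`. Constants are killed by `d/dt`, so such series multiply as in the field
`K((η⁻¹))`, and `Q₀` becomes a unit of `F` (`isUnit_phi_operator_C`). Moreover `d/dt` takes values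
in multiples of `x ^ 2`, so moving a power of `x` across an operator changes that operator only by a
left multiple of `x`. Thus `Q` remains a perturbation of the unit `Q₀` after such moves.

Injectivity. The source is generated over `F` by `1 ⊗ [1]`, and `x` acts bijectively on `V = F / F
Q` (`bijective_phi_tInv_smul`). Hence `w ↦ w • [1]` extends from `W` to its localization `D`
(`exists_extension`). The extension kills `D Q` and induces an `F`-linear map from the target to `V`
which sends the image of `f ⊗ [1]` to `[f]`. If that image is zero, then `f ∈ F Q`, so `f ⊗ [1] =
0`.

Surjectivity. Every element of `D` is `w t ^ k` with `w ∈ W` (`exists_eq_incl_mul`), so it suffices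
to reach `1 ⊗ [t ^ n]`. From `t ^ (n + 1) Q ≡ 0` one gets a relation `Q₀ [t ^ (n + 1)] = -S' [t ^
n]` with `S' ∈ W`. After tensoring, `Q₀` can be inverted, and induction on `n` applies
(`tmul_mk_tInvUnit_mem_range`). -/

theorem monomial_zero_mul_monomial (a : A) (n : ℤ) (b : A) :
    (monomial 0 a * monomial n b : PDO δ) = monomial n (a * b) := by
  ext k
  rw [monomial_zero_mul_coeff, coeff_monomial, coeff_monomial]
  split_ifs <;> simp

/-- Division of all coefficients by a common left divisor, without enlarging the support. -/
theorem exists_eq_monomial_zero_mul {y : A} {P : PDO δ} (h : ∀ i, y ∣ P.coeff i) :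
    ∃ R : PDO δ, P = monomial 0 y * R ∧ ∀ i, P.coeff i = 0 → R.coeff i = 0 := by
  classical
  choose c hc using h
  -- The quotient is forced to be 0 wherever `P` has coefficient 0. This keeps the support bounded
  -- above and, later, keeps quotients of differential operators free of negative powers of `η`.
  have h0 : ∀ i, P.coeff i = 0 → (if P.coeff i = 0 then 0 else c i) = 0 := fun i hi => if_pos hi
  obtain ⟨r, hr⟩ := P.bdd
  refine ⟨mk (fun i => if P.coeff i = 0 then 0 else c i) ⟨r, fun i hi => h0 i (hr i hi)⟩, ?_, h0⟩
  ext i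
  rw [monomial_zero_mul_coeff, coeff_mk]
  split_ifs with hi
  · rw [hi, mul_zero]
  · exact hc i

theorem monomial_zero_mul_cancel {y : A} (hy : IsLeftRegular y) {P R : PDO δ}
    (h : monomial 0 y * P = monomial 0 y * R) : P = R := by
  ext i
  have := congrArg (fun S => coeff S i) h
  simp only [monomial_zero_mul_coeff] at this
  exact hy this

/-- The `α = 0` part of `P * x` is the commutative product and cancels against `x * P`. Every
remaining term contains a value of `δ`. -/
theorem dvd_coeff_mul_monomial_zero_sub {x y : A} (hδ : ∀ a, y ∣ δ a) (P : PDO δ) (k : ℤ) :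
    y ∣ (P * monomial 0 x - monomial 0 x * P).coeff k := by
  classical
  rw [sub_eq_add_neg, coeff_add, coeff_neg, monomial_zero_mul_coeff, coeff_mul,
    -- The index `(k, 0)` is inserted so that the main term can be split off even when it vanishes.
    finsum_eq_sum_of_support_subset (s := insert (k, 0) (term_support_finite P _ k).toFinset) _
      (by intro z hz; simpa using Or.inr hz),
    ← Finset.add_sum_erase _ _ (Finset.mem_insert_self _ _)]
  have h1 : term P (monomial 0 x) k k 0 = x * P.coeff k := by
    simp [term, mul_comm]
  rw [h1, add_neg_eq_iff_eq_add.2 (add_comm _ _)]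
  refine Finset.dvd_sum ?_
  rintro ⟨i, α⟩ hz
  have hne := (Finset.mem_erase.1 hz).1
  rcases α with _ | α
  · have : ¬ (k - i = 0) := fun h0 => hne (by rw [show i = k by omega])
    simp [term, this]
  · rw [term, Function.iterate_succ_apply']
    exact dvd_smul_of_dvd _ (Dvd.dvd.mul_left (hδ _) _)

/-- If `x ^ 2` divides all derivatives, right multiplication by `x` equals left multiplication by
`x` up to a perturbation divisible by `x`. -/
theorem exists_mul_monomial_zero {x : A} (hδ : ∀ a, x ^ 2 ∣ δ a) (P : PDO δ) :
    ∃ R : PDO δ, P * monomial 0 x = monomial 0 x * (P + monomial 0 x * R) := by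
  obtain ⟨R, hR, -⟩ := exists_eq_monomial_zero_mul (dvd_coeff_mul_monomial_zero_sub (x := x) hδ P)
  refine ⟨R, ?_⟩
  rw [mul_add, ← mul_assoc, monomial_zero_mul_monomial, ← pow_two, ← hR]
  abel

/-! ### Operators with constant coefficients -/

section Unit

variable {k B : Type*} [Field k] [CommRing B] [Algebra k B] {d : Derivation k B B}

/-- A Laurent series in `η⁻¹` with constant coefficients. -/
def ofLaurentSeries (d : Derivation k B B) (f : LaurentSeries k) : PDO d :=
  mk (fun i => algebraMap k B (f.coeff (-i))) ⟨-f.order, fun i hi => by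
    rw [HahnSeries.coeff_eq_zero_of_lt_order (by omega), map_zero]⟩

theorem coeff_ofLaurentSeries (f : LaurentSeries k) (i : ℤ) :
    (ofLaurentSeries d f).coeff i = algebraMap k B (f.coeff (-i)) := rfl

theorem ofLaurentSeries_one : ofLaurentSeries d 1 = 1 := by
  ext i
  rw [coeff_ofLaurentSeries, coeff_one, HahnSeries.coeff_one]
  simp only [neg_eq_zero]
  split_ifs <;> simp

/-- Derivations kill constants, so only `α = 0` survives in the product, and what remains is the
Cauchy product under the index change `i ↦ -i`. -/
theorem ofLaurentSeries_mul (f g : LaurentSeries k) :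
    ofLaurentSeries d (f * g) = ofLaurentSeries d f * ofLaurentSeries d g := by
  classical
  ext m
  have hinj : Function.Injective fun z : ℤ × ℤ => ((-z.1, (0 : ℕ)), z.2) := by
    rintro ⟨a, b⟩ ⟨a', b'⟩ h
    simpa using h
  rw [coeff_ofLaurentSeries, coeff_mul, HahnSeries.coeff_mul, map_sum,
    finsum_eq_sum_of_support_subset (s := (antidiagonal f.isPWO_support g.isPWO_support
      (-m)).image fun z : ℤ × ℤ => (-z.1, (0 : ℕ)))]
  · rw [Finset.sum_image]
    · refine Finset.sum_congr rfl ?_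
      rintro ⟨a, b⟩ hz
      have hab : a + b = -m := (Finset.mem_antidiagonal.1 hz).2.2
      simp [term, coeff_ofLaurentSeries, show -(m + a) = b by omega]
    · rintro ⟨a, b⟩ hz ⟨a', b'⟩ hz' h
      have hab : a + b = -m := (Finset.mem_antidiagonal.1 hz).2.2
      have hab' : a' + b' = -m := (Finset.mem_antidiagonal.1 hz').2.2
      simp only [Prod.mk.injEq, and_true] at h ⊢
      omega
  · rintro ⟨i, α⟩ hz
    have hz' : term (ofLaurentSeries d f) (ofLaurentSeries d g) m i α ≠ 0 := hz
    rcases α with _ | α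
    · have hf : f.coeff (-i) ≠ 0 := fun h => hz' (by simp [term, coeff_ofLaurentSeries, h])
      have hg : g.coeff (-(m - i)) ≠ 0 := fun h => hz' (by
        simp only [term, coeff_ofLaurentSeries, Nat.cast_zero, add_zero, h]; simp)
      rw [Finset.mem_coe, Finset.mem_image]
      exact ⟨(-i, -(m - i)), Finset.mem_antidiagonal.2 ⟨hf, hg, by ring⟩, by simp⟩
    · refine absurd ?_ hz'
      rw [term, coeff_ofLaurentSeries, coeff_ofLaurentSeries, Function.iterate_succ_apply,
        Derivation.map_algebraMap, iter_zero]
      simp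

/-- A nonzero formal operator with constant coefficients is invertible. -/
theorem isUnit_of_coeff_mem_range {P : PDO d} (hP : P ≠ 0)
    (h : ∀ i, P.coeff i ∈ Set.range (algebraMap k B)) : IsUnit P := by
  classical
  choose c hc using h
  obtain ⟨r, hr⟩ := P.bdd
  let f : LaurentSeries k := HahnSeries.ofSuppBddBelow
    (fun n => if P.coeff (-n) = 0 then 0 else c (-n)) ⟨-r, fun n hn => by
      by_contra hlt
      exact hn (if_pos (hr _ (by omega)))⟩
  have hf : ofLaurentSeries d f = P := by
    ext i
    change algebraMap k B (if P.coeff (- -i) = 0 then 0 else c (- -i)) = _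
    rw [neg_neg]
    split_ifs with h0
    · rw [h0, map_zero]
    · exact hc i
  have hf0 : f ≠ 0 := by
    intro h0
    apply hP
    rw [← hf, h0]
    ext i
    simp [coeff_ofLaurentSeries]
  refine ⟨⟨P, ofLaurentSeries d f⁻¹, ?_, ?_⟩, rfl⟩
  · rw [← hf, ← ofLaurentSeries_mul, mul_inv_cancel₀ hf0, ofLaurentSeries_one]
  · rw [← hf, ← ofLaurentSeries_mul, inv_mul_cancel₀ hf0, ofLaurentSeries_one]

end Unit

end PDO

end Microloc


namespace Microloc

open Finset

namespace PDO

variable {K A : Type*} [CommRing K] [CommRing A] [Algebra K A] {δ : Derivation K A A}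

theorem monomial_mul_monomial_one (m n : ℤ) (a : A) :
    (monomial m a * monomial n 1 : PDO δ) = monomial (m + n) a := by
  ext k
  rw [coeff_mul, finsum_eq_single _ (m, (0 : ℕ))]
  · have : k + ((0 : ℕ) : ℤ) - m = n ↔ k = m + n := by omega
    simp only [term, coeff_monomial, this]
    split_ifs <;> simp
  · rintro ⟨i, α⟩ h
    by_cases hi : i = m
    · subst hi
      have hα : 0 < α := Nat.pos_of_ne_zero fun h0 => h (by rw [h0])
      rw [term, coeff_monomial, coeff_monomial]
      split_ifs <;> simp [iter_one hα]
    · simp [term, hi]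

/-- Taking the coefficient of `η ^ i`, as an additive map. -/
def coeffHom (δ : Derivation K A A) (i : ℤ) : PDO δ →+ A where
  toFun P := P.coeff i
  map_zero' := rfl
  map_add' _ _ := rfl

end PDO

/-! ### Generation of differential operators, and moving powers of `x` across them -/

namespace DiffOp

variable {K A : Type*} [CommRing K] [CommRing A] [Algebra K A] {δ : Derivation K A A}

theorem coe_coef (a : A) : (coef δ a : PDO δ) = PDO.monomial 0 a := rfl

theorem coef_one : coef δ (1 : A) = 1 := rfl

theorem coef_mul (a b : A) : coef δ (a * b) = coef δ a * coef δ b :=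
  Subtype.ext (PDO.monomial_zero_mul_monomial a 0 b).symm

theorem coef_add (a b : A) : coef δ (a + b) = coef δ a + coef δ b := by
  refine Subtype.ext (PDO.ext fun i => ?_)
  change (if i = 0 then a + b else 0) = (if i = 0 then a else 0) + if i = 0 then b else 0
  split_ifs <;> simp

theorem coe_del_pow (n : ℕ) : ((del δ ^ n : DiffOp δ) : PDO δ) = PDO.monomial n 1 := by
  induction n with
  | zero => rfl
  | succ n ih =>
    rw [pow_succ, Subring.coe_mul, ih]
    exact (PDO.monomial_mul_monomial_one _ _ _).trans (by push_cast; rfl)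

theorem coe_coef_mul_del_pow (a : A) (n : ℕ) :
    ((coef δ a * del δ ^ n : DiffOp δ) : PDO δ) = PDO.monomial n a := by
  rw [Subring.coe_mul, coe_del_pow, coe_coef, PDO.monomial_zero_mul_monomial, mul_one]

theorem induction {p : DiffOp δ → Prop} (hcoef : ∀ a, p (coef δ a)) (hdel : p (del δ))
    (hadd : ∀ P Q, p P → p Q → p (P + Q)) (hmul : ∀ P Q, p P → p Q → p (P * Q))
    (P : DiffOp δ) : p P := by
  have hpow : ∀ n : ℕ, p (del δ ^ n) := fun n => by
    induction n with
    | zero => rw [pow_zero, ← coef_one]; exact hcoef 1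
    | succ n ih => rw [pow_succ]; exact hmul _ _ ih hdel
  -- Induction on a strict bound for the order: subtracting the term in `∂ ^ N` lowers the bound
  -- from `N + 1` to `N`.
  have key : ∀ (N : ℕ) (P : DiffOp δ), (∀ i : ℤ, N ≤ i → (P : PDO δ).coeff i = 0) → p P := by
    intro N
    induction N with
    | zero =>
      intro P hP
      have h0 : P = coef δ 0 := by
        refine Subtype.ext (PDO.ext fun i => ?_)
        rw [coe_coef, PDO.coeff_monomial, ite_self]
        rcases lt_or_ge i 0 with hi | hi
        · exact P.2 i hi
        · exact hP i (by simpa using hi)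
      rw [h0]
      exact hcoef 0
    | succ N ih =>
      intro P hP
      set R := coef δ ((P : PDO δ).coeff N) * del δ ^ N with hR
      rw [← sub_add_cancel P R]
      refine hadd _ _ (ih _ fun i hi => ?_) (hmul _ _ (hcoef _) (hpow N))
      rw [AddSubgroupClass.coe_sub, hR, coe_coef_mul_del_pow, sub_eq_add_neg, PDO.coeff_add,
        PDO.coeff_neg, PDO.coeff_monomial]
      split_ifs with h
      · rw [h, add_neg_cancel]
      · rw [hP i (by push_cast; omega), neg_zero, add_zero]
  obtain ⟨r, hr⟩ := (P : PDO δ).bdd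
  exact key (r + 1).toNat P fun i hi => hr i (by omega)

theorem exists_mul_coef {x : A} (hδ : ∀ a, x ^ 2 ∣ δ a) (P : DiffOp δ) :
    ∃ R : DiffOp δ, P * coef δ x = coef δ x * (P + coef δ x * R) := by
  obtain ⟨R, hR, h0⟩ := PDO.exists_eq_monomial_zero_mul
    (PDO.dvd_coeff_mul_monomial_zero_sub (x := x) hδ (P : PDO δ))
  have hR' : R ∈ DiffOp δ := fun i hi => h0 i ((P * coef δ x - coef δ x * P).2 i hi)
  refine ⟨⟨R, hR'⟩, ?_⟩
  rw [mul_add, ← mul_assoc, ← coef_mul, ← pow_two, ← sub_eq_iff_eq_add']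
  exact Subtype.ext hR

/-- The commutator with `x` is divisible by `x ^ 2`, so one factor `x` is left over after `x` is
pulled out. The errors of the successive moves therefore add up inside the left multiples of `x`. -/
theorem exists_mul_coef_pow {x : A} (hδ : ∀ a, x ^ 2 ∣ δ a) (P : DiffOp δ) (n : ℕ) :
    ∃ R : DiffOp δ, P * coef δ x ^ n = coef δ x ^ n * (P + coef δ x * R) := by
  induction n with
  | zero => exact ⟨0, by simp⟩
  | succ n ih =>
    obtain ⟨R, hR⟩ := ih
    obtain ⟨S, hS⟩ := exists_mul_coef hδ (P + coef δ x * R)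
    exact ⟨R + S, by rw [pow_succ, ← mul_assoc, hR, mul_assoc, hS]; noncomm_ring⟩

/-- The property passes to sums and products, so it is enough to check generators. With `δ x = x c`
one has `x ∂ = (∂ - c) x`. -/
theorem exists_coef_mul_eq {x : A} (hx : x ∣ δ x) (P : DiffOp δ) :
    ∃ R : DiffOp δ, coef δ x * P = R * coef δ x := by
  induction P using induction with
  | hcoef a => exact ⟨coef δ a, by rw [← coef_mul, ← coef_mul, mul_comm]⟩
  | hdel =>
    obtain ⟨c, hc⟩ := hx
    refine ⟨del δ - coef δ c, ?_⟩
    rw [sub_mul, del_mul_coef, hc, ← coef_mul, mul_comm c, add_sub_cancel_right]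
  | hadd P Q hP hQ =>
    obtain ⟨R, hR⟩ := hP
    obtain ⟨S, hS⟩ := hQ
    exact ⟨R + S, by rw [mul_add, hR, hS, add_mul]⟩
  | hmul P Q hP hQ =>
    obtain ⟨R, hR⟩ := hP
    obtain ⟨S, hS⟩ := hQ
    exact ⟨R * S, by rw [← mul_assoc, hR, mul_assoc, hS, mul_assoc]⟩

theorem exists_coef_pow_mul_eq {x : A} (hx : x ∣ δ x) (P : DiffOp δ) (n : ℕ) :
    ∃ R : DiffOp δ, coef δ x ^ n * P = R * coef δ x ^ n := by
  induction n with
  | zero => exact ⟨P, by simp⟩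
  | succ n ih =>
    obtain ⟨R, hR⟩ := ih
    obtain ⟨S, hS⟩ := exists_coef_mul_eq hx R
    exact ⟨S, by rw [pow_succ', mul_assoc, hR, ← mul_assoc, hS, mul_assoc]⟩

end DiffOp

/-! ### Universal property of the extension of scalars -/

section Tensor

open TensorProduct

variable {R S : Type*} [Ring R] [Ring S] {φ : R →+* S}
variable {M P : Type*} [AddCommGroup M] [Module R M] [AddCommGroup P] [Module S P]

namespace ExtendScalars

theorem tmul_add (s : S) (m m' : M) : tmul φ s (m + m') = tmul φ s m + tmul φ s m' :=
  (congrArg (balancing φ M).mkQ (TensorProduct.tmul_add s m m')).trans (map_add _ _ _)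

theorem tmul_zero (s : S) : tmul φ s (0 : M) = 0 :=
  (congrArg (balancing φ M).mkQ (TensorProduct.tmul_zero M s)).trans (map_zero _)

theorem smul_tmul' (s s' : S) (m : M) : s • tmul φ s' m = tmul φ (s * s') m := rfl

theorem tmul_smul (s : S) (r : R) (m : M) : tmul φ s (r • m) = tmul φ (s * φ r) m :=
  ((Submodule.Quotient.eq (balancing φ M)).2 (Submodule.subset_span ⟨s, r, m, rfl⟩)).symm

theorem map_smul_tmul (r : R) (m : M) : φ r • tmul φ 1 m = tmul φ 1 (r • m) := by
  rw [smul_tmul', tmul_smul, one_mul, mul_one]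

@[elab_as_elim]
theorem induction_on {p : ExtendScalars φ M → Prop} (z : ExtendScalars φ M) (zero : p 0)
    (tmul : ∀ s m, p (tmul φ s m)) (add : ∀ x y, p x → p y → p (x + y)) : p z := by
  obtain ⟨z, rfl⟩ := (balancing φ M).mkQ_surjective z
  induction z with
  | zero => rw [map_zero]; exact zero
  | tmul s m => exact tmul s m
  | add x y hx hy => rw [map_add]; exact add _ _ hx hy

/-- The linear map out of an extension of scalars induced by a semilinear map. -/
def lift (g : M →+ P) (hg : ∀ (r : R) (m : M), g (r • m) = φ r • g m) :
    ExtendScalars φ M →ₗ[S] P :=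
  (balancing φ M).liftQ
    (AlgebraTensorModule.lift (LinearMap.toSpanSingleton S (M →ₗ[ℤ] P) g.toIntLinearMap)) (by
      refine Submodule.span_le.2 ?_
      rintro _ ⟨s, r, m, rfl⟩
      change _ = _
      rw [map_sub, sub_eq_zero]
      change (s * φ r) • g m = s • g (r • m)
      rw [hg, mul_smul])

theorem lift_tmul (g : M →+ P) (hg : ∀ (r : R) (m : M), g (r • m) = φ r • g m) (s : S) (m : M) :
    lift g hg (tmul φ s m) = s • g m := rfl

end ExtendScalars

end Tensor

end Microloc


namespace Microloc

/-! ### The element `t⁻¹` and the splitting `Q = Q₀ + t⁻¹ R` -/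

open Finset Polynomial LaurentPolynomial

variable {K : Type*} [Field K]

theorem sq_dvd_polyD (a : K[X]) : X ^ 2 ∣ polyD K a :=
  ⟨-Polynomial.derivative a, by
    simp only [polyD, Derivation.smul_apply, Polynomial.derivative'_apply, smul_eq_mul]; ring⟩

theorem sq_dvd_seriesD (a : PowerSeries K) : PowerSeries.X ^ 2 ∣ seriesD K a :=
  ⟨-PowerSeries.derivative K a, by
    simp only [seriesD, Derivation.smul_apply, smul_eq_mul]; ring⟩

variable (K) in
/-- The element `t⁻¹` of `K[t⁻¹]⟨∂_t⟩`. -/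
def tInv : W K := DiffOp.coef (polyD K) X

theorem exists_mul_tInv_pow (P : W K) (n : ℕ) :
    ∃ R, P * tInv K ^ n = tInv K ^ n * (P + tInv K * R) :=
  DiffOp.exists_mul_coef_pow sq_dvd_polyD P n

theorem exists_tInv_pow_mul_eq (P : W K) (n : ℕ) : ∃ R, tInv K ^ n * P = R * tInv K ^ n :=
  DiffOp.exists_coef_pow_mul_eq ((dvd_pow_self X two_ne_zero).trans (sq_dvd_polyD X)) P n

theorem phi_tInv : phi K (tInv K) = PDO.monomial 0 PowerSeries.X := by
  refine PDO.ext fun i => ?_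
  change Polynomial.coeToPowerSeries.ringHom (if i = 0 then X else 0) = if i = 0 then _ else 0
  split_ifs <;> simp

theorem phi_tInv_mul_cancel {P R : F K} (h : phi K (tInv K) * P = phi K (tInv K) * R) : P = R := by
  rw [phi_tInv] at h
  exact PDO.monomial_zero_mul_cancel (IsRegular.of_ne_zero PowerSeries.X_ne_zero).left h

theorem exists_mul_phi_tInv (P : F K) : ∃ R, P * phi K (tInv K) = phi K (tInv K) * R := by
  rw [phi_tInv]
  obtain ⟨R, hR⟩ := PDO.exists_mul_monomial_zero sq_dvd_seriesD P
  exact ⟨_, hR⟩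

theorem operator_add_tInv_mul_operator (n : ℕ) (b c : ℕ → K[X]) :
    operator n b + tInv K * operator n c = operator n fun v => b v + X * c v := by
  rw [operator, operator, operator, Finset.mul_sum, ← Finset.sum_add_distrib]
  refine Finset.sum_congr rfl fun v _ => ?_
  rw [DiffOp.coef_add, DiffOp.coef_mul, add_mul, tInv, mul_assoc]

theorem operator_eq (n : ℕ) (b : ℕ → K[X]) :
    operator n b = operator n (fun v => Polynomial.C ((b v).eval 0)) +
      tInv K * operator n fun v => (b v).divX := by
  rw [operator_add_tInv_mul_operator]
  refine congrArg _ (funext fun v => ?_)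
  rw [← Polynomial.coeff_zero_eq_eval_zero, add_comm, Polynomial.X_mul_divX_add]

theorem coeff_operator (n : ℕ) (b : ℕ → K[X]) (i : ℤ) :
    (operator n b : PDO (polyD K)).coeff i =
      ∑ v ∈ Finset.range (n + 1), if i = v then b v else 0 := by
  change PDO.coeffHom (polyD K) i ((DiffOp (polyD K)).subtype (operator n b)) = _
  rw [operator, map_sum, map_sum]
  refine Finset.sum_congr rfl fun v _ => ?_
  rw [Subring.subtype_apply, DiffOp.coe_coef_mul_del_pow]
  rfl

/-- All coefficients are constants and the one at `η ^ v` is `c v`, so a nonzero `c v` makes this a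
nonzero constant-coefficient operator. -/
theorem isUnit_phi_operator_C {n : ℕ} {c : ℕ → K} (hc : ∃ v ≤ n, c v ≠ 0) :
    IsUnit (phi K (operator n fun v => Polynomial.C (c v))) := by
  have hcoeff : ∀ i, (phi K (operator n fun v => Polynomial.C (c v))).coeff i =
      algebraMap K (PowerSeries K) (∑ v ∈ Finset.range (n + 1), if i = v then c v else 0) := by
    intro i
    change Polynomial.coeToPowerSeries.ringHom
      ((operator n fun v => Polynomial.C (c v) : PDO (polyD K)).coeff i) = _
    rw [coeff_operator, map_sum, map_sum]
    refine Finset.sum_congr rfl fun v _ => ?_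
    split_ifs <;> simp
  refine PDO.isUnit_of_coeff_mem_range (fun h0 => ?_) fun i => ⟨_, (hcoeff i).symm⟩
  obtain ⟨v, hv, hne⟩ := hc
  have h := hcoeff v
  rw [h0, PDO.coeff_zero, eq_comm, map_eq_zero_iff _ (algebraMap K (PowerSeries K)).injective] at h
  simp [Nat.lt_succ_of_le hv] at h
  exact hne h

/-! ### Action of `t⁻¹` on `F / F Q` -/

section Quotient

variable {q r : F K}

/-- Left multiplication by `t⁻¹` is bijective on `F / F (q + t⁻¹ r)` if `q` is invertible. -/
theorem bijective_phi_tInv_smul (hq : IsUnit q) :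
    Function.Bijective fun v : F K ⧸ Submodule.span (F K) {q + phi K (tInv K) * r} =>
      phi K (tInv K) • v := by
  obtain ⟨u, rfl⟩ := hq
  constructor
  · intro v w h
    rw [← sub_eq_zero]
    replace h : phi K (tInv K) • (v - w) = 0 := by rw [smul_sub]; exact sub_eq_zero.2 h
    generalize v - w = z at h
    obtain ⟨f, rfl⟩ := Submodule.Quotient.mk_surjective _ z
    rw [← Submodule.Quotient.mk_smul, Submodule.Quotient.mk_eq_zero, smul_eq_mul] at h
    obtain ⟨g, hg⟩ := Submodule.mem_span_singleton.1 h
    rw [smul_eq_mul] at hg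
    obtain ⟨g', hg'⟩ := exists_mul_phi_tInv g
    -- With `x = t⁻¹`, the equation `x f = g (u + x r)` and `g x = x g'` give `g u = x (f - g' r)`.
    -- So `g` is a left multiple of `x`, and `x` can be cancelled from the equation.
    have h1 : g = phi K (tInv K) * ((f - g' * r) * ((u⁻¹ : (F K)ˣ) : F K)) := by
      rw [← mul_assoc, Units.eq_mul_inv_iff_mul_eq, mul_sub, ← hg, mul_add, ← mul_assoc g, hg']
      noncomm_ring
    rw [h1, mul_assoc] at hg
    rw [Submodule.Quotient.mk_eq_zero]
    exact Submodule.mem_span_singleton.2 ⟨_, phi_tInv_mul_cancel hg⟩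
  · intro z
    obtain ⟨f, rfl⟩ := Submodule.Quotient.mk_surjective _ z
    obtain ⟨g, hg⟩ := exists_mul_phi_tInv (f * ((u⁻¹ : (F K)ˣ) : F K))
    -- Modulo the relation, `0 ≡ f u⁻¹ (u + x r) = f + x g r`, hence `f ≡ x (-(g r))`.
    refine ⟨Submodule.Quotient.mk (-(g * r)), ?_⟩
    change Submodule.Quotient.mk (phi K (tInv K) * -(g * r)) = _
    rw [Submodule.Quotient.eq]
    refine Submodule.mem_span_singleton.2 ⟨-(f * ((u⁻¹ : (F K)ˣ) : F K)), ?_⟩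
    rw [smul_eq_mul, neg_mul, mul_add, ← mul_assoc _ (phi K (tInv K)), hg,
      Units.inv_mul_cancel_right]
    noncomm_ring

end Quotient

/-! ### `K[t, t⁻¹]⟨∂_t⟩` as the localization of `K[t⁻¹]⟨∂_t⟩` at the powers of `t⁻¹` -/

section Laurent

theorem aeval_T_eq_invert_toLaurent (p : K[X]) :
    (Polynomial.aeval (T (-1) : K[T;T⁻¹])).toRingHom p = invert (Polynomial.toLaurent p) := by
  induction p using Polynomial.induction_on' with
  | add p q hp hq => rw [map_add, hp, hq, map_add, map_add]
  | monomial n a =>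
    rw [← Polynomial.C_mul_X_pow_eq_monomial]
    simp [LaurentPolynomial.T_pow, LaurentPolynomial.algebraMap_apply]

theorem aeval_T_injective :
    Function.Injective (Polynomial.aeval (R := K) (T (-1) : K[T;T⁻¹])).toRingHom := by
  intro p q h
  rw [aeval_T_eq_invert_toLaurent, aeval_T_eq_invert_toLaurent] at h
  exact Polynomial.toLaurent_injective (invert.injective h)

theorem incl_injective : Function.Injective (incl K) := by
  intro P Q h
  refine Subtype.ext (PDO.ext fun i => aeval_T_injective ?_)
  exact congrArg (fun R : D K => (R : PDO (laurentD K)).coeff i) h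

theorem incl_coef (a : K[X]) : incl K (DiffOp.coef (polyD K) a) =
    DiffOp.coef (laurentD K) ((Polynomial.aeval (T (-1) : K[T;T⁻¹])).toRingHom a) := by
  refine Subtype.ext (PDO.ext fun i => ?_)
  change (Polynomial.aeval (T (-1) : K[T;T⁻¹])).toRingHom (if i = 0 then a else 0) =
    if i = 0 then _ else 0
  split_ifs <;> simp

theorem incl_del : incl K (DiffOp.del (polyD K)) = DiffOp.del (laurentD K) := by
  refine Subtype.ext (PDO.ext fun i => ?_)
  change (Polynomial.aeval (T (-1) : K[T;T⁻¹])).toRingHom (if i = 1 then 1 else 0) =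
    if i = 1 then 1 else 0
  split_ifs <;> simp

theorem incl_tInv : incl K (tInv K) = DiffOp.coef (laurentD K) (T (-1)) := by
  rw [tInv, incl_coef]
  simp

variable (K) in
/-- The element `t⁻¹` is invertible in `K[t, t⁻¹]⟨∂_t⟩`. -/
def tInvUnit : (D K)ˣ where
  val := incl K (tInv K)
  inv := DiffOp.coef (laurentD K) (T 1)
  val_inv := by rw [incl_tInv, ← DiffOp.coef_mul, ← T_add]; exact DiffOp.coef_one
  inv_val := by rw [incl_tInv, ← DiffOp.coef_mul, ← T_add]; exact DiffOp.coef_one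

theorem coe_tInvUnit_pow (n : ℕ) : ((tInvUnit K ^ n : (D K)ˣ) : D K) = incl K (tInv K ^ n) := by
  rw [Units.val_pow_eq_pow_val, map_pow]
  rfl

/-- Denominators are cleared on generators. For products, a power of `t⁻¹` is moved across the first
numerator by `exists_tInv_pow_mul_eq`. -/
theorem exists_tInv_pow_mul_eq_incl (d : D K) :
    ∃ (k : ℕ) (w : W K), incl K (tInv K ^ k) * d = incl K w := by
  induction d using DiffOp.induction with
  | hcoef a =>
    -- The positive powers of `t` are the ones to clear here, so the clearing of negative powers is
    -- applied after exchanging `t` and `t⁻¹`.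
    obtain ⟨n, f, hf⟩ := LaurentPolynomial.exists_T_pow (invert a)
    refine ⟨n, DiffOp.coef _ f, ?_⟩
    rw [incl_coef, map_pow, incl_tInv, aeval_T_eq_invert_toLaurent, hf, map_mul,
      LaurentPolynomial.invert_T]
    have : ∀ m : ℕ, DiffOp.coef (laurentD K) (T (-1)) ^ m = DiffOp.coef (laurentD K) (T (-m)) := by
      intro m
      induction m with
      | zero => exact DiffOp.coef_one.symm
      | succ m ih => rw [pow_succ, ih, ← DiffOp.coef_mul, ← T_add]; congr 2; push_cast; ring
    rw [this, ← DiffOp.coef_mul, mul_comm]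
    congr 2
    exact (LaurentPolynomial.involutive_invert a).symm
  | hdel => exact ⟨0, DiffOp.del _, by rw [pow_zero, map_one, one_mul, incl_del]⟩
  | hadd P Q hP hQ =>
    obtain ⟨k, w, h⟩ := hP
    obtain ⟨l, w', h'⟩ := hQ
    refine ⟨k + l, tInv K ^ l * w + tInv K ^ k * w', ?_⟩
    rw [mul_add, map_add, map_mul _ _ w, map_mul _ _ w', ← h, ← h', ← mul_assoc, ← mul_assoc,
      ← map_mul, ← map_mul, ← pow_add, ← pow_add, add_comm l]
  | hmul P Q hP hQ =>
    obtain ⟨k, w, h⟩ := hP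
    obtain ⟨l, w', h'⟩ := hQ
    obtain ⟨w'', h''⟩ := exists_tInv_pow_mul_eq w l
    refine ⟨l + k, w'' * w', ?_⟩
    rw [pow_add, map_mul, mul_assoc, ← mul_assoc _ P, h, ← mul_assoc, ← map_mul, h'', map_mul,
      mul_assoc, h', map_mul]

/-- A right denominator: `d = w t ^ k`. -/
theorem exists_eq_incl_mul (d : D K) :
    ∃ (k : ℕ) (w : W K), d = incl K w * ((tInvUnit K ^ k)⁻¹ : (D K)ˣ) := by
  obtain ⟨k, w, h⟩ := exists_tInv_pow_mul_eq_incl d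
  obtain ⟨R, hR⟩ := exists_mul_tInv_pow w k
  -- With `x = t⁻¹`, `x ^ k d = w` yields `x ^ k (d x ^ k) = w x ^ k = x ^ k (w + x R)`, and `x ^ k`
  -- is a unit of `D`.
  refine ⟨k, w + tInv K * R, ?_⟩
  rw [Units.eq_mul_inv_iff_mul_eq, ← (tInvUnit K ^ k).mul_right_inj, coe_tInvUnit_pow, ← mul_assoc,
    h, ← map_mul, hR, map_mul]

end Laurent

end Microloc


namespace Microloc

open Finset

variable {K : Type*} [Field K]

/-! ### Extending maps from `K[t⁻¹]⟨∂_t⟩` to its localization -/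

section Extension

variable {V : Type*} [AddCommGroup V] [Module (F K) V]

theorem bijective_phi_tInv_pow_smul
    (hx : Function.Bijective fun v : V => phi K (tInv K) • v) (n : ℕ) :
    Function.Bijective fun v : V => phi K (tInv K ^ n) • v := by
  have : (fun v : V => phi K (tInv K ^ n) • v) = (fun v : V => phi K (tInv K) • v)^[n] := by
    rw [smul_iterate, map_pow]
  rw [this]
  exact hx.iterate n

/-- If `t⁻¹` acts bijectively on `V`, a map from `K[t⁻¹]⟨∂_t⟩` to `V` extends to
`K[t, t⁻¹]⟨∂_t⟩`. -/
theorem exists_extension (hx : Function.Bijective fun v : V => phi K (tInv K) • v) (v₀ : V) :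
    ∃ θ : D K →+ V, (∀ w, θ (incl K w) = phi K w • v₀) ∧
      ∀ w d, θ (incl K w * d) = phi K w • θ d := by
  have hinj := fun n => (bijective_phi_tInv_pow_smul hx n).injective
  have hex : ∀ d : D K, ∃ v : V, ∃ (k : ℕ) (w : W K), incl K (tInv K ^ k) * d = incl K w ∧
      phi K (tInv K ^ k) • v = phi K w • v₀ := by
    intro d
    obtain ⟨k, w, h⟩ := exists_tInv_pow_mul_eq_incl d
    obtain ⟨v, hv⟩ := (bijective_phi_tInv_pow_smul hx k).surjective (phi K w • v₀)
    exact ⟨v, k, w, h, hv⟩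
  choose θ hθ using hex
  -- The value at `d` is "`x ^ (-k) w v₀`" for any presentation `x ^ k d = w`, where `x = t⁻¹`.
  -- Independence of the presentation is what makes the chosen function additive and `W`-linear.
  have huniq : ∀ (d : D K) (v : V) (k : ℕ) (w : W K), incl K (tInv K ^ k) * d = incl K w →
      phi K (tInv K ^ k) • v = phi K w • v₀ → θ d = v := by
    intro d v k w h hv
    obtain ⟨l, w', h', hl⟩ := hθ d
    have hw : tInv K ^ k * w' = tInv K ^ l * w := by
      apply incl_injective
      rw [map_mul, map_mul, ← h, ← h', ← mul_assoc, ← mul_assoc, ← map_mul, ← map_mul, ← pow_add,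
        ← pow_add, add_comm]
    refine hinj (k + l) ?_
    change phi K (tInv K ^ (k + l)) • θ d = phi K (tInv K ^ (k + l)) • v
    rw [pow_add, map_mul, mul_smul, hl, ← mul_smul, ← map_mul, hw, map_mul, mul_smul, ← hv,
      ← mul_smul, ← map_mul, ← map_mul, ← pow_add, ← pow_add, add_comm]
  refine ⟨⟨⟨θ, ?_⟩, ?_⟩, ?_, ?_⟩
  · exact huniq 0 0 0 0 (by simp) (by simp)
  · intro d e
    obtain ⟨k, w, h, hk⟩ := hθ d
    obtain ⟨l, w', h', hl⟩ := hθ e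
    refine huniq (d + e) (θ d + θ e) (k + l) (tInv K ^ l * w + tInv K ^ k * w') ?_ ?_
    · rw [mul_add, map_add, map_mul _ _ w, map_mul _ _ w', ← h, ← h', ← mul_assoc, ← mul_assoc,
        ← map_mul, ← map_mul, ← pow_add, ← pow_add, add_comm l]
    · rw [smul_add, map_add, add_smul, map_mul _ _ w, map_mul _ _ w', mul_smul _ (phi K w),
        mul_smul _ (phi K w'), ← hk, ← hl, ← mul_smul, ← mul_smul, ← map_mul, ← map_mul,
        ← pow_add, ← pow_add, add_comm l]
  · intro w
    exact huniq _ _ 0 w (by simp) (by simp)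
  · intro w d
    obtain ⟨k, w', h, hk⟩ := hθ d
    -- From `x ^ k w = R x ^ k` and `x ^ k d = w'`, the product `w d` has the presentation `x ^ k (w
    -- d) = R w'`.
    obtain ⟨R, hR⟩ := exists_tInv_pow_mul_eq w k
    refine huniq _ _ k (R * w') ?_ ?_
    · rw [← mul_assoc, ← map_mul, hR, map_mul, mul_assoc, h, map_mul]
    · change _ • _ • θ d = _
      rw [← mul_smul, ← map_mul, hR, map_mul, mul_smul, hk, ← mul_smul, ← map_mul]

end Extension

/-! ### The natural map -/

namespace QuotD

variable {Q : W K}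

theorem mk_eq_zero {d : D K} : mk Q d = 0 ↔ ∃ e, d = e * incl K Q := by
  refine (Submodule.Quotient.mk_eq_zero (p := Submodule.span (D K) {incl K Q})).trans ?_
  rw [Submodule.mem_span_singleton]
  exact ⟨fun ⟨e, he⟩ => ⟨e, he.symm⟩, fun ⟨e, he⟩ => ⟨e, he.symm⟩⟩

theorem mk_surjective : Function.Surjective (mk Q) := Submodule.Quotient.mk_surjective _

theorem smul_mk (w : W K) (d : D K) : w • mk Q d = mk Q (incl K w * d) := rfl

end QuotD

variable (Q : W K)

/-- The natural map `K[t⁻¹]⟨∂_t⟩ / K[t⁻¹]⟨∂_t⟩ Q → K[t, t⁻¹]⟨∂_t⟩ / K[t, t⁻¹]⟨∂_t⟩ Q`. -/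
def quotMap : QuotW Q →ₗ[W K] QuotD Q :=
  (Submodule.span (W K) {Q}).liftQ
    { toFun := fun P => QuotD.mk Q (incl K P)
      map_add' := fun P R => by rw [map_add]; rfl
      map_smul' := fun P R => by rw [smul_eq_mul, map_mul]; rfl } (by
    refine Submodule.span_le.2 (Set.singleton_subset_iff.2 ?_)
    exact QuotD.mk_eq_zero.2 ⟨1, (one_mul _).symm⟩)

theorem quotMap_mk (P : W K) : quotMap Q (QuotW.mk Q P) = QuotD.mk Q (incl K P) := rfl

/-- The natural map between the microlocalizations. -/
def microlocMap :
    Microlocalization (K := K) (QuotW Q) →ₗ[F K] Microlocalization (K := K) (QuotD Q) :=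
  ExtendScalars.lift (φ := phi K) (M := QuotW Q)
    { toFun := fun m : QuotW Q => ExtendScalars.tmul (phi K) 1 (quotMap Q m)
      map_zero' := by rw [map_zero, ExtendScalars.tmul_zero]
      map_add' := fun m m' => by rw [map_add, ExtendScalars.tmul_add] } fun w m => by
    change ExtendScalars.tmul (phi K) 1 (quotMap Q (w • m)) = _
    rw [map_smul]
    exact (ExtendScalars.map_smul_tmul w (quotMap Q m)).symm

theorem microlocMap_tmul (f : F K) (P : W K) :
    microlocMap Q (ExtendScalars.tmul (phi K) f (QuotW.mk Q P)) =
      ExtendScalars.tmul (phi K) f (QuotD.mk Q (incl K P)) := by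
  change f • ExtendScalars.tmul (phi K) 1 (quotMap Q (QuotW.mk Q P)) = _
  rw [ExtendScalars.smul_tmul', mul_one, quotMap_mk]

/-- Since `[P] = P • [1]`, the operator `P` moves through the tensor sign into the left factor. -/
theorem exists_eq_tmul_mk_one (z : Microlocalization (K := K) (QuotW Q)) :
    ∃ f, z = ExtendScalars.tmul (phi K) f (QuotW.mk Q 1) := by
  induction z using ExtendScalars.induction_on with
  | zero => exact ⟨0, (zero_smul (F K) (ExtendScalars.tmul (phi K) 1 (QuotW.mk Q 1))).symm.trans
      (by rw [ExtendScalars.smul_tmul', zero_mul])⟩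
  | tmul f m =>
    obtain ⟨P, rfl⟩ := Submodule.Quotient.mk_surjective _ m
    refine ⟨f * phi K P, ?_⟩
    rw [← ExtendScalars.tmul_smul]
    congr 1
    change QuotW.mk Q P = QuotW.mk Q (P * 1)
    rw [mul_one]
  | add x y hx hy =>
    obtain ⟨f, rfl⟩ := hx
    obtain ⟨g, rfl⟩ := hy
    refine ⟨f + g, ?_⟩
    have h : ∀ f : F K, ExtendScalars.tmul (phi K) f (QuotW.mk Q 1) =
        f • ExtendScalars.tmul (phi K) 1 (QuotW.mk Q 1) := fun f => by
      rw [ExtendScalars.smul_tmul', mul_one]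
    rw [h f, h g, h (f + g), add_smul]

/-! ### Bijectivity of the natural map -/

variable {Q} {Q₀ R : W K}

theorem microlocMap_injective (hQ : Q = Q₀ + tInv K * R) (hQ₀ : IsUnit (phi K Q₀)) :
    Function.Injective (microlocMap Q) := by
  have hx := bijective_phi_tInv_smul (r := phi K R) hQ₀
  rw [← map_mul, ← map_add, ← hQ] at hx
  set V := F K ⧸ Submodule.span (F K) {phi K Q}
  obtain ⟨θ, hθ, hθ'⟩ := exists_extension hx (Submodule.Quotient.mk 1 : V)
  have hQ0 : phi K Q • (Submodule.Quotient.mk 1 : V) = 0 := by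
    rw [← Submodule.Quotient.mk_smul, Submodule.Quotient.mk_eq_zero, smul_eq_mul, mul_one]
    exact Submodule.mem_span_singleton_self _
  -- `θ` is linear only over `W`, so `e ∈ D` is first multiplied by a power of `t⁻¹` to land in `W`;
  -- that power acts injectively on `V`.
  have hker : ∀ e, θ (e * incl K Q) = 0 := by
    intro e
    obtain ⟨k, w, h⟩ := exists_tInv_pow_mul_eq_incl e
    refine (bijective_phi_tInv_pow_smul hx k).injective ?_
    change phi K (tInv K ^ k) • _ = phi K (tInv K ^ k) • (0 : V)
    rw [← hθ', ← mul_assoc, h, hθ', ← mul_one (incl K Q), hθ', ← map_one (incl K), hθ, map_one,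
      one_smul, hQ0, smul_zero, smul_zero]
  let ψ : QuotD Q →+ V := QuotientAddGroup.lift
    (Submodule.span (D K) {incl K Q}).toAddSubgroup θ (by
      intro d hd
      obtain ⟨e, rfl⟩ := Submodule.mem_span_singleton.1 hd
      exact hker e)
  have hψ : ∀ d, ψ (QuotD.mk Q d) = θ d := fun _ => rfl
  -- The composite of `Ψ` with the natural map sends `f ⊗ [1]` to the class of `f` in `F / F Q`,
  -- which detects whether `f ∈ F Q`.
  let Ψ : Microlocalization (K := K) (QuotD Q) →ₗ[F K] V := ExtendScalars.lift ψ fun w m => by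
    obtain ⟨d, rfl⟩ := QuotD.mk_surjective m
    rw [QuotD.smul_mk, hψ, hψ, hθ']
  rw [injective_iff_map_eq_zero]
  intro z hz
  obtain ⟨f, rfl⟩ := exists_eq_tmul_mk_one Q z
  have h1 := congrArg Ψ hz
  rw [microlocMap_tmul, map_zero, ExtendScalars.lift_tmul, hψ, hθ, map_one, one_smul,
    ← Submodule.Quotient.mk_smul, Submodule.Quotient.mk_eq_zero, smul_eq_mul, mul_one] at h1
  obtain ⟨g, rfl⟩ := Submodule.mem_span_singleton.1 h1
  rw [smul_eq_mul, ← ExtendScalars.tmul_smul]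
  have h2 : Q • QuotW.mk Q 1 = 0 := by
    change QuotW.mk Q (Q * 1) = 0
    rw [mul_one]
    exact (Submodule.Quotient.mk_eq_zero _).2 (Submodule.mem_span_singleton_self _)
  rw [h2, ExtendScalars.tmul_zero]

theorem tmul_mk_tInvUnit_mem_range (hQ : Q = Q₀ + tInv K * R) (hQ₀ : IsUnit (phi K Q₀)) (n : ℕ) :
    ExtendScalars.tmul (phi K) 1 (QuotD.mk Q ((tInvUnit K ^ n)⁻¹ : (D K)ˣ)) ∈
      LinearMap.range (microlocMap Q) := by
  induction n with
  | zero =>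
    refine ⟨ExtendScalars.tmul (phi K) 1 (QuotW.mk Q 1), ?_⟩
    rw [microlocMap_tmul, map_one, pow_zero, inv_one, Units.val_one]
  | succ n ih =>
    obtain ⟨S, hS⟩ := exists_mul_tInv_pow Q (n + 1)
    obtain ⟨S', hS'⟩ := exists_tInv_pow_mul_eq (R + S) 1
    rw [pow_one] at hS'
    set u := tInvUnit K ^ (n + 1) with hu
    -- Here `u⁻¹ = t ^ (n + 1)`: conjugating `Q` by this power only adds a left multiple of `t⁻¹`.
    have h1 : incl K (Q + tInv K * S) * (u⁻¹ : (D K)ˣ) = (u⁻¹ : (D K)ˣ) * incl K Q := by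
      rw [Units.mul_inv_eq_iff_eq_mul, mul_assoc, Units.eq_inv_mul_iff_mul_eq, hu,
        coe_tInvUnit_pow, ← map_mul, ← map_mul, hS]
    have h2 : (Q + tInv K * S) • QuotD.mk Q (u⁻¹ : (D K)ˣ) = 0 := by
      rw [QuotD.smul_mk, h1]
      exact QuotD.mk_eq_zero.2 ⟨_, rfl⟩
    have h3 : tInv K • QuotD.mk Q (u⁻¹ : (D K)ˣ) =
        QuotD.mk Q ((tInvUnit K ^ n)⁻¹ : (D K)ˣ) := by
      rw [QuotD.smul_mk]
      change QuotD.mk Q ((tInvUnit K * u⁻¹ : (D K)ˣ) : D K) = _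
      rw [hu, pow_succ, mul_inv_rev, mul_inv_cancel_left]
    -- With `t⁻¹` on the right of the perturbation, it lowers `[t ^ (n + 1)]` to `[t ^ n]`, where
    -- the induction hypothesis applies.
    have hQS : Q + tInv K * S = Q₀ + S' * tInv K := by
      rw [hQ, add_assoc, ← mul_add, hS']
    rw [hQS, add_smul, mul_smul, h3] at h2
    have h4 : phi K Q₀ • ExtendScalars.tmul (phi K) 1 (QuotD.mk Q (u⁻¹ : (D K)ˣ)) ∈
        LinearMap.range (microlocMap Q) := by
      rw [ExtendScalars.map_smul_tmul, eq_neg_of_add_eq_zero_left h2, ← neg_smul,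
        ← ExtendScalars.map_smul_tmul]
      exact Submodule.smul_mem _ _ ih
    obtain ⟨v, hv⟩ := hQ₀
    rw [← hv] at h4
    have h5 := Submodule.smul_mem _ ((v⁻¹ : (F K)ˣ) : F K) h4
    rwa [← mul_smul, Units.inv_mul, one_smul] at h5

theorem microlocMap_surjective (hQ : Q = Q₀ + tInv K * R) (hQ₀ : IsUnit (phi K Q₀)) :
    Function.Surjective (microlocMap Q) := by
  rw [← LinearMap.range_eq_top, eq_top_iff]
  rintro z -
  induction z using ExtendScalars.induction_on with
  | zero => exact Submodule.zero_mem _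
  | tmul f m =>
    obtain ⟨d, rfl⟩ := QuotD.mk_surjective m
    obtain ⟨k, w, rfl⟩ := exists_eq_incl_mul d
    rw [← QuotD.smul_mk, ExtendScalars.tmul_smul, ← mul_one (f * phi K w),
      ← ExtendScalars.smul_tmul']
    exact Submodule.smul_mem _ _ (tmul_mk_tInvUnit_mem_range hQ hQ₀ k)
  | add x y hx hy => exact Submodule.add_mem _ hx hy

end Microloc

end

theorem proposition1 {K : Type*} [Field K] [CharZero K] (n : ℕ) (b : ℕ → Polynomial K)
    (hb : ∃ v : ℕ, v ≤ n ∧ (b v).eval 0 ≠ 0) :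
    ∃ e : Microloc.Microlocalization (Microloc.QuotW (Microloc.operator n b)) ≃ₗ[Microloc.W K]
        Microloc.Microlocalization (Microloc.QuotD (Microloc.operator n b)),
      (∀ (f : Microloc.F K) (P : Microloc.W K),
        e (Microloc.ExtendScalars.tmul (Microloc.phi K) f
            (Microloc.QuotW.mk (Microloc.operator n b) P)) =
          Microloc.ExtendScalars.tmul (Microloc.phi K) f
            (Microloc.QuotD.mk (Microloc.operator n b) (Microloc.incl K P))) ∧
      (∀ (g : Microloc.F K)
        (x : Microloc.Microlocalization (Microloc.QuotW (Microloc.operator n b))),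
        e (g • x) = g • e x) := by
  have hQ := Microloc.operator_eq n b
  have hQ₀ := Microloc.isUnit_phi_operator_C (c := fun v => (b v).eval 0) hb
  let E := LinearEquiv.ofBijective (Microloc.microlocMap (Microloc.operator n b))
    ⟨Microloc.microlocMap_injective hQ hQ₀, Microloc.microlocMap_surjective hQ hQ₀⟩
  -- On both sides `W` acts through `phi`, so `F`-linearity already contains `W`-linearity.
  exact ⟨{ E with map_smul' := fun w x => E.map_smul (Microloc.phi K w) x },
    Microloc.microlocMap_tmul _, fun g x => E.map_smul g x⟩
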